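/- Let $K$ be an algebraically closed field of arbitrary characteristic, $n\ge 1$, $R=K[[x_1,\dots,x_n]]$, and $\mathfrak m=\langle x_1,\dots,x_n\rangle$ its maximal ideal. A $C$-polytope $P$ is given by a nonempty finite set $W\subset\mathbb Q_{>0}^n$ of weight vectors that is irredundant, i.e. no $w\in W$ can be dropped from the minimum $\lambda_P:\mathbb R^n\to\mathbb R$, $\lambda_P(r)=\min_{w\in W} w\cdot r$, without changing it. Let $N_P$ be the lowest common multiple of the denominators of all entries of the weight vectors. For $f=\sum_\alpha a_\alpha x^\alpha\in R$ put $v_P(f)=\min\{N_P\lambda_P(\alpha)\mid a_\alpha\ne 0\}$, with $v_P(0)=\infty$. For a $K$-derivation $\xi=\sum_{i}\sum_\alpha a_{i,\alpha}x^\alpha\partial_{x_i}$ of $R$ put $v_P(\xi)=\min\{N_P\lambda_P(\alpha-e_i)\mid a_{i,\alpha}\neq 0\}$, with $v_P(0)=\infty$, where $e_i$ is the $i$-th standard basis vector. For $d\in\mathbb N$ let $F_d=\{f\in R\mid v_P(f)\ge d\}$. The initial form $\mathrm{In}_P(f)$ is the sum of those terms $a_\alpha x^\alpha$ of $f$ with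 $N_P\lambda_P(\alpha)=v_P(f)$. Put $$\mathrm j_P^A(f)_d=\{\xi f\mid \xi\in\mathrm{Der}_K(R),\ v_P(\xi)+v_P(f)\ge d\},\qquad \mathrm{gr}_P^A(M_f)=\bigoplus_{d\ge 0}F_d/\big(\mathrm j_P^A(f)_d+F_{d+1}\big).$$ We say that $f$ satisfies AA (with respect to $P$) if $\dim_K \mathrm{gr}_P^A(M_f)<\infty$. A regular basis for $M_f$ is a set $B$ of monomials whose classes form a $K$-basis of $\mathrm{gr}_P^A(M_f)$, where the class of $x^\alpha$ is taken in degree $v_P(x^\alpha)$. We write $f\sim_r g$ if $f=\varphi(g)$ for some $K$-algebra automorphism $\varphi$ of $R$, and call $f$ right $k$-determined if $f\sim_r g$ for every $g\in R$ that has the same coefficients as $f$ at all monomials of degree at most $k$. **Corollary (finite determinacy bound for right equivalence).** Let $P$ be a $C$-polytope and $f\in\mathfrak m$ such that $\mathrm{In}_P(f)$ satisfies AA, and let $B$ be a regular basis for $M_{\mathrm{In}_P(f)}$. Then $$d:=\max\big(\{v_P(\mathrm{In}_P(f))\}\cup\{v_P(x^\alpha)\mid x^\alpha\in B\}\big)$$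 exists and is finite, and $f\sim_r g$ for every $g\in R$ with $v_P(f-g)>d$. In particular, for every $k\in\mathbb N$ with $\mathfrak m^{k+1}\subseteq F_{d+1}$, the power series $f$ is right $k$-determined. -/

import Mathlib

/-- A `C`-polytope in the orthant of `ℝⁿ`, given by its finite irredundant set of positive rational
weight vectors: none of the linear functions `r ↦ w · r` can be dropped from their minimum. -/
structure CPolytope (n : ℕ) where
  weights : Finset (Fin n → ℚ)
  nonempty : weights.Nonempty
  pos : ∀ w ∈ weights, ∀ j, 0 < w j
  irredundant : ∀ w ∈ weights, ∃ r : Fin n → ℝ, ∀ w' ∈ weights, w' ≠ w →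
    ∑ j, (w j : ℝ) * r j < ∑ j, (w' j : ℝ) * r j

namespace CPolytope

variable {n : ℕ} (P : CPolytope n) {K : Type*} [Field K]

/-- The concave piecewise linear function `λ_P(r) = min_w (w · r)` on all of `ℝⁿ`. -/
noncomputable def lam (r : Fin n → ℝ) : ℝ :=
  P.weights.inf' P.nonempty fun w => ∑ j, (w j : ℝ) * r j

/-- `N_P`: the lowest common multiple of the denominators of all entries of the weight vectors. -/
def denom : ℕ := P.weights.lcm fun w => Finset.univ.lcm fun j => (w j).den

/-- The integer `N_P · λ_P(z)` for `z ∈ ℤⁿ`; no rounding takes place, see `coe_deg`. -/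
noncomputable def deg (z : Fin n → ℤ) : ℤ := ⌊(P.denom : ℝ) * P.lam fun j => (z j : ℝ)⌋

theorem coe_deg (z : Fin n → ℤ) :
    (P.deg z : ℝ) = (P.denom : ℝ) * P.lam fun j => (z j : ℝ) := by
  obtain ⟨w, hw, h⟩ := P.weights.exists_mem_eq_inf' P.nonempty
    fun w => ∑ j, (w j : ℝ) * (z j : ℝ)
  have hint : ∀ j, ∃ m : ℤ, (P.denom : ℝ) * (w j : ℝ) = m := by
    intro j
    obtain ⟨c, hc⟩ : (w j).den ∣ P.denom :=
      (Finset.dvd_lcm (f := fun j => (w j).den) (Finset.mem_univ j)).trans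
        (Finset.dvd_lcm (f := fun w : Fin n → ℚ => Finset.univ.lcm fun j => (w j).den) hw)
    refine ⟨c * (w j).num, ?_⟩
    have h1 : (w j) * (w j).den = (w j).num := Rat.mul_den_eq_num _
    have h2 : ((w j : ℚ) : ℝ) * ((w j).den : ℝ) = ((w j).num : ℝ) := by exact_mod_cast h1
    rw [hc]
    push_cast
    rw [← h2]
    ring
  choose m hm using hint
  have key : (P.denom : ℝ) * P.lam (fun j => (z j : ℝ)) = ((∑ j, m j * z j : ℤ) : ℝ) := by
    unfold lam
    rw [h, Finset.mul_sum]
    push_cast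
    refine Finset.sum_congr rfl fun j _ => ?_
    rw [← hm j]
    ring
  unfold deg
  rw [key, Int.floor_intCast]

theorem lam_mono {r s : Fin n → ℝ} (h : ∀ j, r j ≤ s j) : P.lam r ≤ P.lam s := by
  unfold lam
  refine Finset.le_inf' _ _ fun w hw => (Finset.inf'_le _ hw).trans ?_
  refine Finset.sum_le_sum fun j _ => ?_
  have := P.pos w hw j
  exact mul_le_mul_of_nonneg_left (h j) (by exact_mod_cast this.le)

theorem deg_mono {y z : Fin n → ℤ} (h : ∀ j, y j ≤ z j) : P.deg y ≤ P.deg z := by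
  unfold deg
  refine Int.floor_le_floor (mul_le_mul_of_nonneg_left (P.lam_mono fun j => ?_) (Nat.cast_nonneg _))
  exact_mod_cast h j

theorem deg_zero : P.deg 0 = 0 := by
  have h : P.lam (fun j => (((0 : Fin n → ℤ) j : ℤ) : ℝ)) = 0 := by
    unfold lam
    simp
  unfold deg
  rw [h]
  simp

/-- The minimum of `N_P · λ_P` on a set of lattice points, which is `∞` for the empty set. It is
only used for sets whose points have all coordinates `≥ -1`, where `N_P · λ_P` is bounded below. -/
noncomputable def minDeg (S : Set (Fin n → ℤ)) : WithTop ℤ :=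
  sInf ((fun z => (P.deg z : WithTop ℤ)) '' S)

theorem le_minDeg {S : Set (Fin n → ℤ)} (hS : ∀ z ∈ S, ∀ j, -1 ≤ z j) (a : WithTop ℤ) :
    a ≤ P.minDeg S ↔ ∀ z ∈ S, a ≤ (P.deg z : WithTop ℤ) := by
  unfold minDeg
  rcases S.eq_empty_or_nonempty with rfl | hne
  · simp [WithTop.sInf_empty]
  · rw [le_csInf_iff ?_ (hne.image _)]
    · simp
    · refine ⟨(P.deg fun _ => -1 : ℤ), ?_⟩
      rintro _ ⟨z, hz, rfl⟩
      exact WithTop.coe_le_coe.2 (P.deg_mono (hS z hz))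

/-- A multi-exponent as a lattice point. -/
def latticePoint (α : Fin n →₀ ℕ) : Fin n → ℤ := fun j => (α j : ℤ)

/-- The piecewise valuation `v_P(f)`, the minimum of `N_P · λ_P` on the support of `f`; `∞` for
`f = 0`. -/
noncomputable def val (f : MvPowerSeries (Fin n) K) : WithTop ℤ :=
  P.minDeg {z | ∃ α, MvPowerSeries.coeff α f ≠ 0 ∧ z = latticePoint α}

/-- The piecewise valuation of a derivation `ξ = ∑ᵢ ∑_α a_{i,α} x^α ∂ᵢ`, that is, the minimum of
`N_P · λ_P(α - eᵢ)` over all `(i, α)` with `a_{i,α} ≠ 0`; here `∑_α a_{i,α} x^α = ξ(xᵢ)`. It is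
`∞` for `ξ = 0`. -/
noncomputable def valDer
    (ξ : Derivation K (MvPowerSeries (Fin n) K) (MvPowerSeries (Fin n) K)) : WithTop ℤ :=
  P.minDeg {z | ∃ i α, MvPowerSeries.coeff α (ξ (MvPowerSeries.X i)) ≠ 0 ∧
    z = latticePoint α - Pi.single i 1}

theorem le_val (f : MvPowerSeries (Fin n) K) (a : WithTop ℤ) :
    a ≤ P.val f ↔
      ∀ α, MvPowerSeries.coeff α f ≠ 0 → a ≤ (P.deg (latticePoint α) : WithTop ℤ) := by
  unfold val
  rw [P.le_minDeg]
  · constructor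
    · exact fun h α hα => h _ ⟨α, hα, rfl⟩
    · rintro h _ ⟨α, hα, rfl⟩
      exact h α hα
  · rintro _ ⟨α, -, rfl⟩ j
    have : (0 : ℤ) ≤ latticePoint α j := Int.natCast_nonneg _
    lia

theorem le_valDer (ξ : Derivation K (MvPowerSeries (Fin n) K) (MvPowerSeries (Fin n) K))
    (a : WithTop ℤ) :
    a ≤ P.valDer ξ ↔ ∀ i α, MvPowerSeries.coeff α (ξ (MvPowerSeries.X i)) ≠ 0 →
      a ≤ (P.deg (latticePoint α - Pi.single i 1) : WithTop ℤ) := by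
  unfold valDer
  rw [P.le_minDeg]
  · constructor
    · exact fun h i α hα => h _ ⟨i, α, hα, rfl⟩
    · rintro h _ ⟨i, α, hα, rfl⟩
      exact h i α hα
  · rintro _ ⟨i, α, -, rfl⟩ j
    have h1 : (0 : ℤ) ≤ latticePoint α j := Int.natCast_nonneg _
    have h2 : (Pi.single i 1 : Fin n → ℤ) j ≤ 1 := by
      rw [Pi.single_apply]
      split_ifs <;> simp
    simp only [Pi.sub_apply]
    lia

theorem exists_coeff_ne_zero_of_mul {g h : MvPowerSeries (Fin n) K} {α : Fin n →₀ ℕ}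
    (H : MvPowerSeries.coeff α (g * h) ≠ 0) :
    ∃ β, MvPowerSeries.coeff β h ≠ 0 ∧ ∀ j, β j ≤ α j := by
  classical
  rw [MvPowerSeries.coeff_mul] at H
  obtain ⟨p, hp, hne⟩ := Finset.exists_ne_zero_of_sum_ne_zero H
  refine ⟨p.2, right_ne_zero_of_mul hne, fun j => ?_⟩
  have := DFunLike.congr_fun (Finset.HasAntidiagonal.mem_antidiagonal.1 hp) j
  rw [Finsupp.add_apply] at this
  lia

theorem min_le_val_add (f g : MvPowerSeries (Fin n) K) :
    min (P.val f) (P.val g) ≤ P.val (f + g) := by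
  rw [le_val]
  intro α hα
  by_cases hf : MvPowerSeries.coeff α f = 0
  · have hg : MvPowerSeries.coeff α g ≠ 0 := fun h => hα (by simp [hf, h])
    exact (min_le_right _ _).trans ((P.le_val g _).1 le_rfl α hg)
  · exact (min_le_left _ _).trans ((P.le_val f _).1 le_rfl α hf)

theorem val_le_val_mul (g f : MvPowerSeries (Fin n) K) : P.val f ≤ P.val (g * f) := by
  rw [le_val]
  intro α hα
  obtain ⟨β, hβ, hle⟩ := exists_coeff_ne_zero_of_mul hα
  refine ((P.le_val f _).1 le_rfl β hβ).trans (WithTop.coe_le_coe.2 (P.deg_mono fun j => ?_))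
  exact Int.ofNat_le.2 (hle j)

theorem min_le_valDer_add
    (ξ η : Derivation K (MvPowerSeries (Fin n) K) (MvPowerSeries (Fin n) K)) :
    min (P.valDer ξ) (P.valDer η) ≤ P.valDer (ξ + η) := by
  rw [le_valDer]
  intro i α hα
  by_cases hf : MvPowerSeries.coeff α (ξ (MvPowerSeries.X i)) = 0
  · have hg : MvPowerSeries.coeff α (η (MvPowerSeries.X i)) ≠ 0 := fun h => hα (by simp [hf, h])
    exact (min_le_right _ _).trans ((P.le_valDer η _).1 le_rfl i α hg)
  · exact (min_le_left _ _).trans ((P.le_valDer ξ _).1 le_rfl i α hf)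

theorem valDer_le_valDer_smul (g : MvPowerSeries (Fin n) K)
    (ξ : Derivation K (MvPowerSeries (Fin n) K) (MvPowerSeries (Fin n) K)) :
    P.valDer ξ ≤ P.valDer (g • ξ) := by
  rw [le_valDer]
  intro i α hα
  rw [Derivation.smul_apply, smul_eq_mul] at hα
  obtain ⟨β, hβ, hle⟩ := exists_coeff_ne_zero_of_mul hα
  refine ((P.le_valDer ξ _).1 le_rfl i β hβ).trans (WithTop.coe_le_coe.2 (P.deg_mono fun j => ?_))
  simp only [Pi.sub_apply, latticePoint]
  have := hle j
  lia

/-- The ideal `F_d = {f | v_P(f) ≥ d}` of the piecewise filtration. -/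
noncomputable def filtration (K : Type*) [Field K] (d : ℕ) : Ideal (MvPowerSeries (Fin n) K) where
  carrier := {f | ((d : ℤ) : WithTop ℤ) ≤ P.val f}
  zero_mem' := by simp [le_val]
  add_mem' := fun {f g} hf hg => (le_min hf hg).trans (P.min_le_val_add f g)
  smul_mem' := fun g f hf => le_trans hf (P.val_le_val_mul g f)

/-- The initial form (principal part) of `f` with respect to `P`. -/
noncomputable def initialForm (f : MvPowerSeries (Fin n) K) : MvPowerSeries (Fin n) K :=
  open Classical in
  fun α => if (P.deg (latticePoint α) : WithTop ℤ) = P.val f then MvPowerSeries.coeff α f else 0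

/-- The ideal `{ξ f | ξ a derivation, v_P(ξ) + v_P(f) ≥ d}`. -/
noncomputable def jacobianA (f : MvPowerSeries (Fin n) K) (d : ℕ) :
    Ideal (MvPowerSeries (Fin n) K) where
  carrier := {h | ∃ ξ : Derivation K (MvPowerSeries (Fin n) K) (MvPowerSeries (Fin n) K),
    ((d : ℤ) : WithTop ℤ) ≤ P.valDer ξ + P.val f ∧ h = ξ f}
  zero_mem' := by
    refine ⟨0, ?_, by simp⟩
    have : P.valDer (0 : Derivation K (MvPowerSeries (Fin n) K) (MvPowerSeries (Fin n) K)) = ⊤ :=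
      top_le_iff.1 ((P.le_valDer _ _).2 (by simp))
    rw [this]
    simp
  add_mem' := by
    rintro _ _ ⟨ξ, hξ, rfl⟩ ⟨η, hη, rfl⟩
    refine ⟨ξ + η, le_trans ?_ (add_le_add_left (P.min_le_valDer_add ξ η) _), by simp⟩
    rcases min_choice (P.valDer ξ) (P.valDer η) with h | h <;> rw [h] <;> assumption
  smul_mem' := by
    rintro g _ ⟨ξ, hξ, rfl⟩
    exact ⟨g • ξ, hξ.trans (add_le_add_left (P.valDer_le_valDer_smul g ξ) _), by simp⟩

/-- The subspace `j_d + F_{d+1}` of `F_d`, where `j_d` is `jacobianA P f d`. -/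
noncomputable def grARelations (f : MvPowerSeries (Fin n) K) (d : ℕ) :
    Submodule K ((P.filtration K d).restrictScalars K) :=
  ((P.jacobianA f d ⊔ P.filtration K (d + 1)).restrictScalars K).comap
    ((P.filtration K d).restrictScalars K).subtype

/-- The graded piece `F_d / (j_d + F_{d+1})`. -/
def GrAPiece (f : MvPowerSeries (Fin n) K) (d : ℕ) : Type _ :=
  ((P.filtration K d).restrictScalars K) ⧸ P.grARelations f d

noncomputable instance instAddCommGroupGrAPiece (f : MvPowerSeries (Fin n) K) (d : ℕ) :
    AddCommGroup (P.GrAPiece f d) :=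
  Submodule.Quotient.addCommGroup (P.grARelations f d)

noncomputable instance instModuleGrAPiece (f : MvPowerSeries (Fin n) K) (d : ℕ) :
    Module K (P.GrAPiece f d) :=
  Submodule.Quotient.module (P.grARelations f d)

/-- The `K`-vector space `gr_P^A(M_f) = ⨁_d F_d / (j_d + F_{d+1})`. -/
abbrev GrA (f : MvPowerSeries (Fin n) K) : Type _ := DirectSum ℕ (P.GrAPiece f)

/-- The power series `f` satisfies condition AA with respect to `P`. -/
def ConditionAA (f : MvPowerSeries (Fin n) K) : Prop := FiniteDimensional K (P.GrA f)

theorem deg_nonneg (α : Fin n →₀ ℕ) : 0 ≤ P.deg (latticePoint α) := by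
  rw [← P.deg_zero]
  exact P.deg_mono fun j => Int.natCast_nonneg _

theorem monomial_mem_filtration (α : Fin n →₀ ℕ) :
    (MvPowerSeries.monomial α (1 : K)) ∈
      (P.filtration K (P.deg (latticePoint α)).toNat).restrictScalars K := by
  change _ ≤ P.val _
  rw [le_val, Int.toNat_of_nonneg (P.deg_nonneg α)]
  intro β hβ
  classical
  rw [MvPowerSeries.coeff_monomial] at hβ
  have h : β = α := by
    by_contra h
    exact hβ (if_neg h)
  rw [h]

/-- The class of the monomial `x^α` in `gr_P^A(M_f)`, a homogeneous element of degree
`v_P(x^α) = N_P · λ_P(α)`. -/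
noncomputable def monomialClass (f : MvPowerSeries (Fin n) K) (α : Fin n →₀ ℕ) : P.GrA f :=
  DirectSum.of (P.GrAPiece f) (P.deg (latticePoint α)).toNat
    ((P.grARelations f _).mkQ ⟨MvPowerSeries.monomial α 1, P.monomial_mem_filtration α⟩)

/-- The set of monomials `{x^α | α ∈ Λ}` is a regular basis for the Milnor algebra `M_f`: the
classes of its elements form a `K`-basis of `gr_P^A(M_f)`. -/
def IsRegularBasis (f : MvPowerSeries (Fin n) K) (Λ : Set (Fin n →₀ ℕ)) : Prop :=
  LinearIndependent K (fun α : Λ => P.monomialClass f α) ∧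
    Submodule.span K (P.monomialClass f '' Λ) = ⊤

end CPolytope

/-- Right equivalence: `f = φ(g)` for a `K`-algebra automorphism `φ` of `K[[x₁, …, xₙ]]`. -/
def RightEquivalent {n : ℕ} {K : Type*} [Field K] (f g : MvPowerSeries (Fin n) K) : Prop :=
  ∃ φ : MvPowerSeries (Fin n) K ≃ₐ[K] MvPowerSeries (Fin n) K, f = φ g

/-- `f` is right `k`-determined: it is right equivalent to every `g` with the same terms up to
order `k`. -/
def RightDetermined {n : ℕ} {K : Type*} [Field K] (k : ℕ) (f : MvPowerSeries (Fin n) K) : Prop :=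
  ∀ g : MvPowerSeries (Fin n) K,
    (∀ α : Fin n →₀ ℕ, α.degree ≤ k → MvPowerSeries.coeff α f = MvPowerSeries.coeff α g) →
      RightEquivalent f g

/-! Finiteness of `gr_P^A` bounds the degrees of the regular basis, so the graded pieces of degree
`e > d` vanish: every element of `F_e` is `ξ(In f)` modulo `F_{e+1}`, for some `ξ` with `v_P(ξ) ≥ e
- v_P(f)`. Since `d ≥ v_P(f)`, this lower bound is at least 1. Changing a substitution `xᵢ ↦ xᵢ +
ηᵢ` to `xᵢ ↦ xᵢ + ηᵢ + ξ(xᵢ)` changes the image of `f` by `ξ(In f)` up to `F_{e+1}`, so it pushes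
the error `g - φ(f)` from `F_e` into `F_{e+1}` (`exists_derivation_improvement`). The corrections
converge, and the limit substitution maps `f` to `g` (`exists_subst_eq`). It raises orders strictly
above the identity, hence is an automorphism (`bijective_substAlgHom`).

The function `λ_P` is not additive, but it is a minimum of linear forms. A bound `v_P ≥ c` is
therefore a simultaneous bound for the additive order of each weight, and every estimate is proved
for one additive `L` at a time.

The estimates are checked on monomials by induction, adding one variable at a time, and extended to
series through `IsOrderLocal`. No Taylor coefficients are divided, so the characteristic plays no
role. -/

namespace MvPowerSeries

variable {n : ℕ} {K : Type*} [Field K]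

/-! ### Weighted orders and convergence -/

/-- All monomials `x^α` of `f` satisfy `c ≤ D α`. -/
def OrderGE (D : (Fin n →₀ ℕ) → ℝ) (c : ℝ) (f : MvPowerSeries (Fin n) K) : Prop :=
  ∀ α, coeff α f ≠ 0 → c ≤ D α

namespace OrderGE

variable {D : (Fin n →₀ ℕ) → ℝ} {c d : ℝ} {f g : MvPowerSeries (Fin n) K}

theorem zero : OrderGE D c (0 : MvPowerSeries (Fin n) K) := fun α h => absurd (by simp) h

theorem mono (hf : OrderGE D c f) (h : d ≤ c) : OrderGE D d f := fun α hα => h.trans (hf α hα)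

theorem add (hf : OrderGE D c f) (hg : OrderGE D c g) : OrderGE D c (f + g) := by
  intro α hα
  by_cases h : coeff α f = 0
  · exact hg α fun h' => hα (by simp [h, h'])
  · exact hf α h

theorem neg (hf : OrderGE D c f) : OrderGE D c (-f) := fun α hα => hf α fun h => hα (by simp [h])

theorem sub (hf : OrderGE D c f) (hg : OrderGE D c g) : OrderGE D c (f - g) := by
  rw [sub_eq_add_neg]
  exact hf.add hg.neg

theorem mul {L : (Fin n →₀ ℕ) →+ ℝ} (hf : OrderGE L c f) (hg : OrderGE L d g) :
    OrderGE L (c + d) (f * g) := by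
  classical
  intro α hα
  rw [coeff_mul] at hα
  obtain ⟨p, hp, hne⟩ := Finset.exists_ne_zero_of_sum_ne_zero hα
  rw [← Finset.HasAntidiagonal.mem_antidiagonal.1 hp, map_add]
  exact add_le_add (hf _ (left_ne_zero_of_mul hne)) (hg _ (right_ne_zero_of_mul hne))

theorem of_monomial (α : Fin n →₀ ℕ) (a : K) : OrderGE D (D α) (monomial α a) := by
  classical
  intro β hβ
  rw [coeff_monomial] at hβ
  split_ifs at hβ with h
  · rw [h]
  · exact absurd rfl hβ

theorem of_X (i : Fin n) :
    OrderGE D (D (Finsupp.single i 1)) (X i : MvPowerSeries (Fin n) K) :=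
  of_monomial _ _

theorem eq_zero (h : ∀ k : ℕ, OrderGE D k f) : f = 0 := by
  ext α
  by_contra hα
  obtain ⟨k, hk⟩ := exists_nat_gt (D α)
  exact absurd (h k α hα) (not_le.2 hk)

/-- Each coefficient of the series `∑ u j` is a finite sum. Additivity of `D` is not needed, so the
piecewise linear degree is allowed as `D`. -/
theorem exists_limit (D : (Fin n →₀ ℕ) → ℝ) (u : ℕ → MvPowerSeries (Fin n) K)
    (hu : ∀ k : ℕ, OrderGE D k (u k)) :
    ∃ h, ∀ k : ℕ, OrderGE D k (h - ∑ j ∈ Finset.range k, u j) := by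
  -- A term `u j` with `j > D α` has no monomial `x^α`, so summing up to `⌊D α⌋₊` already gives the
  -- full coefficient.
  let h : MvPowerSeries (Fin n) K := fun α => coeff α (∑ j ∈ Finset.range (⌊D α⌋₊ + 1), u j)
  have hh : ∀ α, coeff α h = coeff α (∑ j ∈ Finset.range (⌊D α⌋₊ + 1), u j) := fun _ => rfl
  refine ⟨h, fun k α hα => ?_⟩
  by_contra! hlt
  have key : ∀ m : ℕ, D α < m → coeff α (∑ j ∈ Finset.range (max m k), u j) =
      coeff α (∑ j ∈ Finset.range m, u j) := by
    intro m hm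
    rw [map_sum, map_sum]
    refine (Finset.sum_subset (Finset.range_mono (le_max_left _ _)) fun j _ hj => ?_).symm
    by_contra hne
    have h1 := hu j α hne
    have h2 : (m : ℝ) ≤ j := by exact_mod_cast not_lt.1 (Finset.mem_range.not.1 hj)
    linarith
  have key' : coeff α (∑ j ∈ Finset.range (max (⌊D α⌋₊ + 1) k), u j) =
      coeff α (∑ j ∈ Finset.range k, u j) := by
    rw [map_sum, map_sum]
    refine (Finset.sum_subset (Finset.range_mono (le_max_right _ _)) fun j _ hj => ?_).symm
    by_contra hne
    have h1 := hu j α hne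
    have h2 : (k : ℝ) ≤ j := by exact_mod_cast not_lt.1 (Finset.mem_range.not.1 hj)
    linarith
  apply hα
  rw [map_sub, hh, ← key', key _ (by exact_mod_cast Nat.lt_floor_add_one (D α)), sub_self]

end OrderGE

/-! ### Continuity of linear operators and reduction to monomials -/

/-- A linear map that lowers the order of a power series at most by one. -/
def IsOrderLocal (T : MvPowerSeries (Fin n) K →ₗ[K] MvPowerSeries (Fin n) K) : Prop :=
  ∀ (m : ℕ) f, (∀ α : Fin n →₀ ℕ, α.degree < m + 1 → coeff α f = 0) →
    ∀ α : Fin n →₀ ℕ, α.degree < m → coeff α (T f) = 0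

theorem IsOrderLocal.sub {T U : MvPowerSeries (Fin n) K →ₗ[K] MvPowerSeries (Fin n) K}
    (hT : IsOrderLocal T) (hU : IsOrderLocal U) : IsOrderLocal (T - U) := by
  intro m f hf α hα
  rw [LinearMap.sub_apply, map_sub, hT m f hf α hα, hU m f hf α hα, sub_zero]

theorem isOrderLocal_substAlgHom {a : Fin n → MvPowerSeries (Fin n) K} (ha : HasSubst a)
    (h0 : ∀ i, constantCoeff (a i) = 0) : IsOrderLocal (substAlgHom (R := K) ha).toLinearMap := by
  intro m f hf α hα
  apply coeff_of_lt_order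
  have h1 : ((m + 1 : ℕ) : ℕ∞) ≤ f.order := nat_le_order hf
  have h2 : (1 : ℕ∞) ≤ ⨅ i, (a i).order :=
    le_iInf fun i => one_le_order_iff_constCoeff_eq_zero.2 (h0 i)
  have h3 := le_order_subst ha f
  rw [AlgHom.toLinearMap_apply, substAlgHom_apply]
  refine lt_of_lt_of_le ?_ ((mul_le_mul' h2 h1).trans h3)
  rw [one_mul]
  exact_mod_cast hα.trans (Nat.lt_succ_self _)

/-- Each monomial is divided by the first variable occurring in it; `q i` collects the quotients of
those whose first variable is `X i`. -/
theorem eq_sum_X_mul {f : MvPowerSeries (Fin n) K} {m : ℕ}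
    (hf : ∀ α : Fin n →₀ ℕ, α.degree < m + 1 → coeff α f = 0) :
    ∃ q : Fin n → MvPowerSeries (Fin n) K, f = ∑ i, X i * q i ∧
      ∀ i, ∀ α : Fin n →₀ ℕ, α.degree < m → coeff α (q i) = 0 := by
  classical
  let q : Fin n → MvPowerSeries (Fin n) K := fun i β =>
    if ∀ j < i, β j = 0 then coeff (β + Finsupp.single i 1) f else 0
  have hq : ∀ i β, coeff β (q i) =
    if ∀ j < i, β j = 0 then coeff (β + Finsupp.single i 1) f else 0 := fun i β => rfl
  refine ⟨q, ?_, fun i α hα => ?_⟩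
  · ext α
    have hX : ∀ i, coeff α (X i * q i) =
        if α i ≠ 0 ∧ ∀ j < i, α j = 0 then coeff α f else 0 := by
      intro i
      rw [X, coeff_monomial_mul, one_mul]
      by_cases hi : α i = 0
      · rw [if_neg (by simp [hi]), if_neg (by simp [hi])]
      · have hle : Finsupp.single i 1 ≤ α := by simpa using Nat.one_le_iff_ne_zero.2 hi
        rw [if_pos hle, hq, tsub_add_cancel_of_le hle]
        have : (∀ j < i, (α - Finsupp.single i 1 : Fin n →₀ ℕ) j = 0) ↔ α i ≠ 0 ∧ ∀ j < i, α j = 0 := by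
          simp only [hi, ne_eq, not_false_eq_true, true_and]
          refine forall₂_congr fun j hj => ?_
          simp [hj.ne']
        simp only [this]
    rw [map_sum, Finset.sum_congr rfl fun i _ => hX i]
    by_cases h0 : α = 0
    · subst h0
      simpa using hf 0 (by simp)
    · have hex : ∃ i, α i ≠ 0 := by
        by_contra! h
        exact h0 (Finsupp.ext h)
      have hne : (Finset.univ.filter fun i => α i ≠ 0).Nonempty :=
        hex.imp fun i hi => by simp [hi]
      set i₀ := (Finset.univ.filter fun i => α i ≠ 0).min' hne with hi₀
      have hmem : α i₀ ≠ 0 := (Finset.mem_filter.1 (Finset.min'_mem _ hne)).2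
      have hmin : ∀ j, α j ≠ 0 → i₀ ≤ j := fun j hj => Finset.min'_le _ _ (by simp [hj])
      rw [Finset.sum_eq_single i₀, if_pos]
      · exact ⟨hmem, fun j hj => by_contra fun h => absurd (hmin j h) (not_le.2 hj)⟩
      · intro j _ hj
        rw [if_neg]
        rintro ⟨h1, h2⟩
        exact hmem (h2 _ (lt_of_le_of_ne (hmin j h1) hj.symm))
      · simp
  · rw [hq]
    split_ifs
    · exact hf _ (by rw [map_add, Finsupp.degree_single]; lia)
    · rfl

theorem coeff_mul_eq_zero_of_order {f g : MvPowerSeries (Fin n) K} {m : ℕ}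
    (hg : ∀ α : Fin n →₀ ℕ, α.degree < m → coeff α g = 0) (α : Fin n →₀ ℕ) (hα : α.degree < m) :
    coeff α (f * g) = 0 := by
  apply coeff_of_lt_order
  refine lt_of_lt_of_le (Nat.cast_lt.2 hα) ((nat_le_order hg).trans ?_)
  exact le_add_self.trans le_order_mul

/-- Derivations are automatically continuous: the Leibniz rule on `∑ X i * q i` lets the factor `X
i` restore the order that `ξ` may lose on `q i`. -/
theorem isOrderLocal_derivation
    (ξ : Derivation K (MvPowerSeries (Fin n) K) (MvPowerSeries (Fin n) K)) :
    IsOrderLocal (ξ : MvPowerSeries (Fin n) K →ₗ[K] MvPowerSeries (Fin n) K) := by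
  intro m
  induction m with
  | zero => exact fun f _ α hα => absurd hα (Nat.not_lt_zero _)
  | succ m ih =>
    intro f hf α hα
    obtain ⟨q, rfl, hq⟩ := eq_sum_X_mul hf
    rw [map_sum, map_sum]
    refine Finset.sum_eq_zero fun i _ => ?_
    rw [Derivation.coeFn_coe, Derivation.leibniz, map_add, smul_eq_mul, smul_eq_mul,
      mul_comm (q i), coeff_mul_eq_zero_of_order (hq i) α hα, add_zero]
    apply coeff_of_lt_order
    have h1 : (1 : ℕ∞) ≤ (X i : MvPowerSeries (Fin n) K).order :=
      one_le_order_iff_constCoeff_eq_zero.2 (by simp)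
    have h2 : (m : ℕ∞) ≤ (ξ (q i)).order := nat_le_order (ih (q i) (hq i))
    refine lt_of_lt_of_le ?_ ((add_le_add h1 h2).trans le_order_mul)
    rw [add_comm]
    exact_mod_cast hα

/-- A coefficient of `T f` depends only on a truncation of `f`, so it is a finite linear combination
of coefficients of images of monomials of `f`. -/
theorem IsOrderLocal.exists_coeff_ne_zero
    {T : MvPowerSeries (Fin n) K →ₗ[K] MvPowerSeries (Fin n) K} (hT : IsOrderLocal T)
    {f : MvPowerSeries (Fin n) K} {α : Fin n →₀ ℕ} (h : coeff α (T f) ≠ 0) :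
    ∃ β, coeff β f ≠ 0 ∧ coeff α (T (monomial β 1)) ≠ 0 := by
  -- Degree `α.degree` must lie strictly below `m`, and `T` may lose one order, hence the truncation
  -- at `m + 1`.
  set m := α.degree + 1 with hm
  set p := truncTotal (m + 1) f with hp
  have h1 : coeff α (T (f - p)) = 0 := by
    refine hT m _ (fun β hβ => ?_) α (Nat.lt_succ_self _)
    rw [map_sub, MvPolynomial.coeff_coe, coeff_truncTotal _ hβ, sub_self]
  have h2 : coeff α (T p) ≠ 0 := by
    rw [map_sub, map_sub, sub_eq_zero] at h1
    rwa [← h1]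
  have h3 : (p : MvPowerSeries (Fin n) K) =
      ∑ β ∈ p.support, p.coeff β • monomial β (1 : K) := by
    conv_lhs => rw [p.as_sum]
    rw [← MvPolynomial.coeToMvPowerSeries.ringHom_apply, map_sum]
    refine Finset.sum_congr rfl fun β _ => ?_
    rw [MvPolynomial.coeToMvPowerSeries.ringHom_apply, MvPolynomial.coe_monomial,
      ← map_smul, smul_eq_mul, mul_one]
  rw [h3, map_sum, map_sum] at h2
  obtain ⟨β, -, hβ⟩ := Finset.exists_ne_zero_of_sum_ne_zero h2
  rw [map_smul, map_smul, smul_eq_mul] at hβ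
  refine ⟨β, fun h0 => left_ne_zero_of_mul hβ ?_, right_ne_zero_of_mul hβ⟩
  by_cases hlt : β.degree < m + 1
  · rw [hp, coeff_truncTotal _ hlt, h0]
  · exact coeff_truncTotal_eq_zero _ (not_lt.1 hlt)

theorem IsOrderLocal.orderGE {T : MvPowerSeries (Fin n) K →ₗ[K] MvPowerSeries (Fin n) K}
    (hT : IsOrderLocal T) {D : (Fin n →₀ ℕ) → ℝ} {s c : ℝ}
    (h : ∀ β, OrderGE D (D β + s) (T (monomial β 1))) {f : MvPowerSeries (Fin n) K}
    (hf : OrderGE D c f) : OrderGE D (c + s) (T f) := by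
  intro α hα
  obtain ⟨β, h1, h2⟩ := hT.exists_coeff_ne_zero hα
  exact (add_le_add_left (hf β h1) s).trans (h β α h2)

/-! ### Order estimates for substitutions and derivations -/

/-- The tuple `ξ` is the coefficient tuple of a vector field of `L`-order at least `s`. -/
def TupleOrderGE (L : (Fin n →₀ ℕ) → ℝ) (s : ℝ) (ξ : Fin n → MvPowerSeries (Fin n) K) : Prop :=
  ∀ i, OrderGE L (L (Finsupp.single i 1) + s) (ξ i)

variable {L : (Fin n →₀ ℕ) →+ ℝ}

/-- The constant monomial has `L`-order 0, below the positive order required of `η i`. -/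
theorem constantCoeff_eq_zero_of_orderGE (hL : ∀ i, 0 < L (Finsupp.single i 1)) {s : ℝ}
    (hs : 0 ≤ s) {η : Fin n → MvPowerSeries (Fin n) K} (hη : TupleOrderGE L s η) (i : Fin n) :
    constantCoeff (X i + η i) = 0 := by
  rw [map_add, constantCoeff_X, zero_add]
  by_contra h
  have h1 := hη i 0 h
  rw [map_zero] at h1
  linarith [hL i]

theorem hasSubst_X_add (hL : ∀ i, 0 < L (Finsupp.single i 1)) {s : ℝ}
    (hs : 0 ≤ s) {η : Fin n → MvPowerSeries (Fin n) K} (hη : TupleOrderGE L s η) :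
    HasSubst fun i => X i + η i :=
  hasSubst_of_constantCoeff_zero (constantCoeff_eq_zero_of_orderGE hL hs hη)

theorem TupleOrderGE.add {D : (Fin n →₀ ℕ) → ℝ} {s : ℝ} {ξ η : Fin n → MvPowerSeries (Fin n) K}
    (hξ : TupleOrderGE D s ξ) (hη : TupleOrderGE D s η) : TupleOrderGE D s (ξ + η) :=
  fun i => (hξ i).add (hη i)

theorem TupleOrderGE.mono {D : (Fin n →₀ ℕ) → ℝ} {s t : ℝ} {ξ : Fin n → MvPowerSeries (Fin n) K}
    (hξ : TupleOrderGE D s ξ) (h : t ≤ s) : TupleOrderGE D t ξ :=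
  fun i => (hξ i).mono (by linarith)

theorem monomial_add_single (β : Fin n →₀ ℕ) (i : Fin n) :
    monomial (β + Finsupp.single i 1) (1 : K) = monomial β 1 * X i := by
  rw [X, monomial_mul_monomial, one_mul]

theorem monomial_induction {p : (Fin n →₀ ℕ) → Prop} (h0 : p 0)
    (h : ∀ β i, p β → p (β + Finsupp.single i 1)) (β : Fin n →₀ ℕ) : p β := by
  induction hd : β.degree generalizing β with
  | zero => rwa [(Finsupp.degree_eq_zero_iff β).1 hd]
  | succ k ih =>
    obtain ⟨i, hi⟩ : ∃ i, β i ≠ 0 := by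
      by_contra! h'
      rw [show β = 0 from Finsupp.ext h', map_zero] at hd
      exact absurd hd (by simp)
    have hle : Finsupp.single i 1 ≤ β := by simpa using Nat.one_le_iff_ne_zero.2 hi
    rw [← tsub_add_cancel_of_le hle] at hd ⊢
    rw [map_add, Finsupp.degree_single] at hd
    exact h _ i (ih _ (by lia))

theorem orderGE_substAlgHom_monomial
    {η : Fin n → MvPowerSeries (Fin n) K} (hη : TupleOrderGE L 0 η)
    (ha : HasSubst fun i => X i + η i) (β : Fin n →₀ ℕ) :
    OrderGE L (L β) (substAlgHom (R := K) ha (monomial β 1)) := by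
  induction β using monomial_induction with
  | h0 =>
    rw [monomial_zero_eq_C_apply, map_one, map_one]
    exact OrderGE.of_monomial 0 1
  | h β i ih =>
    rw [monomial_add_single, map_mul, substAlgHom_X, map_add]
    exact ih.mul ((OrderGE.of_X i).add ((hη i).mono (by linarith)))

theorem orderGE_substAlgHom_monomial_sub {s : ℝ} (hs : 0 ≤ s)
    {η ξ : Fin n → MvPowerSeries (Fin n) K}
    (hη : TupleOrderGE L 0 η) (hξ : TupleOrderGE L s ξ)
    (ha : HasSubst fun i => X i + η i) (hb : HasSubst fun i => X i + (η + ξ) i)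
    (β : Fin n →₀ ℕ) :
    OrderGE L (L β + s) (substAlgHom (R := K) hb (monomial β 1) -
      substAlgHom (R := K) ha (monomial β 1)) := by
  induction β using monomial_induction with
  | h0 =>
    rw [monomial_zero_eq_C_apply, map_one, map_one, map_one, sub_self]
    exact OrderGE.zero
  | h β i ih =>
    rw [monomial_add_single, map_mul, map_mul, substAlgHom_X, substAlgHom_X, map_add,
      show ∀ A B x y z : MvPowerSeries (Fin n) K,
        A * (x + y) - B * z = (A - B) * (x + y) + B * (x + y - z) by intros; ring]
    have h1 : OrderGE L (L (Finsupp.single i 1)) (X i + (η + ξ) i) :=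
      (OrderGE.of_X i).add ((hη.add (hξ.mono hs) i).mono (by linarith))
    have h2 : X i + (η + ξ) i - (X i + η i) = ξ i := by
      rw [Pi.add_apply]; ring
    rw [h2]
    exact ((ih.mul h1).mono (by linarith)).add
      (((orderGE_substAlgHom_monomial hη ha β).mul (hξ i)).mono (by linarith))

theorem orderGE_derivation_monomial {s : ℝ}
    {ξ : Derivation K (MvPowerSeries (Fin n) K) (MvPowerSeries (Fin n) K)}
    (hξ : TupleOrderGE L s fun i => ξ (X i)) (β : Fin n →₀ ℕ) :
    OrderGE L (L β + s) (ξ (monomial β 1)) := by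
  induction β using monomial_induction with
  | h0 =>
    rw [monomial_zero_eq_C_apply, map_one, ξ.map_one_eq_zero]
    exact OrderGE.zero
  | h β i ih =>
    rw [monomial_add_single, ξ.leibniz, smul_eq_mul, smul_eq_mul, map_add]
    exact (((OrderGE.of_monomial β 1).mul (hξ i)).mono (by linarith)).add
      (((OrderGE.of_X i).mul ih).mono (by linarith))

/-- First-order Taylor expansion with remainder. The derivation acts on the monomial itself and not
on its image under the substitution by `η`; as `η` has order at least 1, this discrepancy is
absorbed by the remainder. -/
theorem orderGE_taylor_monomial {s : ℝ} (hs : 1 ≤ s)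
    (hL : ∀ i, 0 < L (Finsupp.single i 1)) {η : Fin n → MvPowerSeries (Fin n) K}
    {ξ : Derivation K (MvPowerSeries (Fin n) K) (MvPowerSeries (Fin n) K)}
    (hη : TupleOrderGE L 1 η) (hξ : TupleOrderGE L s fun i => ξ (X i))
    (ha : HasSubst fun i => X i + η i) (hb : HasSubst fun i => X i + (η + fun i => ξ (X i)) i)
    (β : Fin n →₀ ℕ) :
    OrderGE L (L β + (s + 1)) (substAlgHom (R := K) hb (monomial β 1) -
      substAlgHom (R := K) ha (monomial β 1) - ξ (monomial β 1)) := by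
  have hs0 : (0 : ℝ) ≤ s := zero_le_one.trans hs
  have hη0 := hη.mono zero_le_one
  induction β using monomial_induction with
  | h0 =>
    rw [monomial_zero_eq_C_apply, map_one, map_one, map_one, ξ.map_one_eq_zero,
      sub_self, sub_self]
    exact OrderGE.zero
  | h β i ih =>
    have hx : TupleOrderGE L 0 (0 : Fin n → MvPowerSeries (Fin n) K) := fun _ => OrderGE.zero
    have h0 : HasSubst fun i => X i + (0 : Fin n → MvPowerSeries (Fin n) K) i :=
      hasSubst_X_add hL le_rfl hx
    have hid : substAlgHom (R := K) h0 (monomial β 1) =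
        monomial β 1 := by
      rw [substAlgHom_apply]
      simp only [Pi.zero_apply, add_zero]
      exact congr_fun subst_self _
    have hA := orderGE_substAlgHom_monomial_sub hs0 hη0 hξ ha hb β
    have hc : HasSubst fun i => X i + (0 + η) i := by simpa using ha
    have hB := orderGE_substAlgHom_monomial_sub zero_le_one hx hη h0 hc β
    rw [hid] at hB
    simp only [zero_add] at hB
    rw [monomial_add_single, map_mul, map_mul, substAlgHom_X, substAlgHom_X, map_add,
      ξ.leibniz, smul_eq_mul, smul_eq_mul, Pi.add_apply,
      -- The three terms gain `s + 1` from the induction hypothesis, from `s` plus the order 1 of `η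
      -- i + ξ (X i)`, and from 1 plus the order `s` of `ξ (X i)`.
      show ∀ A B D x y z m : MvPowerSeries (Fin n) K,
        A * (x + (y + z)) - B * (x + y) - (m * z + x * D) =
          (A - B - D) * x + ((A - B) * (y + z) + (B - m) * z) by intros; ring]
    have h2 : OrderGE L (L (Finsupp.single i 1) + 1) (η i + ξ (X i)) :=
      (hη.add (hξ.mono hs) i)
    exact ((ih.mul (OrderGE.of_X i)).mono (by linarith)).add
      (((hA.mul h2).mono (by linarith)).add ((hB.mul (hξ i)).mono (by linarith)))

theorem OrderGE.derivation {s c : ℝ}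
    {ξ : Derivation K (MvPowerSeries (Fin n) K) (MvPowerSeries (Fin n) K)}
    (hξ : TupleOrderGE L s fun i => ξ (X i)) {f : MvPowerSeries (Fin n) K} (hf : OrderGE L c f) :
    OrderGE L (c + s) (ξ f) :=
  (isOrderLocal_derivation ξ).orderGE (orderGE_derivation_monomial hξ) hf

theorem OrderGE.subst (hL : ∀ i, 0 < L (Finsupp.single i 1))
    {η : Fin n → MvPowerSeries (Fin n) K} (hη : TupleOrderGE L 0 η)
    {c : ℝ} {f : MvPowerSeries (Fin n) K} (hf : OrderGE L c f) :
    OrderGE L c (MvPowerSeries.subst (fun i => X i + η i) f) := by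
  have ha := hasSubst_X_add hL le_rfl hη
  have h := (isOrderLocal_substAlgHom ha (constantCoeff_eq_zero_of_orderGE hL le_rfl hη)).orderGE
    (s := 0) (fun β => by simpa using orderGE_substAlgHom_monomial hη ha β) hf
  rwa [add_zero, AlgHom.toLinearMap_apply, substAlgHom_apply] at h

theorem OrderGE.subst_sub {s : ℝ} (hs : 0 ≤ s)
    (hL : ∀ i, 0 < L (Finsupp.single i 1)) {η ξ : Fin n → MvPowerSeries (Fin n) K}
    (hη : TupleOrderGE L 0 η) (hξ : TupleOrderGE L s ξ)
    {c : ℝ} {f : MvPowerSeries (Fin n) K} (hf : OrderGE L c f) :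
    OrderGE L (c + s) (MvPowerSeries.subst (fun i => X i + (η + ξ) i) f -
      MvPowerSeries.subst (fun i => X i + η i) f) := by
  have hηξ := hη.add (hξ.mono hs)
  have ha := hasSubst_X_add hL le_rfl hη
  have hb := hasSubst_X_add hL le_rfl hηξ
  have h := ((isOrderLocal_substAlgHom hb
    (constantCoeff_eq_zero_of_orderGE hL le_rfl hηξ)).sub (isOrderLocal_substAlgHom ha
    (constantCoeff_eq_zero_of_orderGE hL le_rfl hη))).orderGE
    (orderGE_substAlgHom_monomial_sub hs hη hξ ha hb) hf
  simpa [substAlgHom_apply] using h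

theorem OrderGE.subst_sub_sub_derivation {s : ℝ} (hs : 1 ≤ s)
    (hL : ∀ i, 0 < L (Finsupp.single i 1)) {η : Fin n → MvPowerSeries (Fin n) K}
    {ξ : Derivation K (MvPowerSeries (Fin n) K) (MvPowerSeries (Fin n) K)}
    (hη : TupleOrderGE L 1 η) (hξ : TupleOrderGE L s fun i => ξ (X i))
    {c : ℝ} {f : MvPowerSeries (Fin n) K} (hf : OrderGE L c f) :
    OrderGE L (c + (s + 1)) (MvPowerSeries.subst (fun i => X i + (η + fun i => ξ (X i)) i) f -
      MvPowerSeries.subst (fun i => X i + η i) f - ξ f) := by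
  have hη0 := hη.mono zero_le_one
  have hηξ := hη0.add (hξ.mono (zero_le_one.trans hs))
  have ha := hasSubst_X_add hL le_rfl hη0
  have hb := hasSubst_X_add hL le_rfl hηξ
  have h := (((isOrderLocal_substAlgHom hb
    (constantCoeff_eq_zero_of_orderGE hL le_rfl hηξ)).sub (isOrderLocal_substAlgHom ha
    (constantCoeff_eq_zero_of_orderGE hL le_rfl hη0))).sub (isOrderLocal_derivation ξ)).orderGE
    (orderGE_taylor_monomial hs hL hη hξ ha hb) hf
  simpa [substAlgHom_apply] using h

/-! ### Substitutions close to the identity are automorphisms -/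

theorem subst_X_add_zero (f : MvPowerSeries (Fin n) K) :
    subst (fun i => X i + (0 : Fin n → MvPowerSeries (Fin n) K) i) f = f := by
  simp only [Pi.zero_apply, add_zero]
  exact congr_fun subst_self _

theorem OrderGE.subst_sub_self (hL : ∀ i, 0 < L (Finsupp.single i 1))
    {η : Fin n → MvPowerSeries (Fin n) K} (hη : TupleOrderGE L 1 η)
    {c : ℝ} {f : MvPowerSeries (Fin n) K} (hf : OrderGE L c f) :
    OrderGE L (c + 1) (MvPowerSeries.subst (fun i => X i + η i) f - f) := by
  have h := OrderGE.subst_sub zero_le_one hL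
    (η := 0) (fun _ => OrderGE.zero) hη hf
  rwa [subst_X_add_zero, zero_add] at h

/-- A substitution `xᵢ ↦ xᵢ + ηᵢ` that strictly raises the order is an automorphism. -/
theorem bijective_substAlgHom (hL : ∀ i, 0 < L (Finsupp.single i 1))
    {η : Fin n → MvPowerSeries (Fin n) K} (hη : TupleOrderGE L 1 η)
    (ha : HasSubst fun i => X i + η i) : Function.Bijective (substAlgHom (R := K) ha) := by
  have hpos : ∀ f : MvPowerSeries (Fin n) K, OrderGE L ((0 : ℕ) : ℝ) f := by
    intro f α hα
    clear hα
    rw [Nat.cast_zero]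
    induction α using monomial_induction with
    | h0 => rw [map_zero]
    | h β i ih =>
      rw [map_add]
      exact add_nonneg ih (hL i).le
  -- The identity minus the substitution raises the order by one, so a kernel element has
  -- arbitrarily high order and the Neumann series converges.
  have hsub : ∀ {k : ℕ} {f : MvPowerSeries (Fin n) K}, OrderGE L k f →
      OrderGE L ((k + 1 : ℕ) : ℝ) (f - substAlgHom (R := K) ha f) := by
    intro k f hf
    rw [Nat.cast_succ, ← neg_sub, substAlgHom_apply]
    exact (hf.subst_sub_self hL hη).neg
  constructor
  · rw [injective_iff_map_eq_zero]
    refine fun h hh => OrderGE.eq_zero (D := L) fun k => ?_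
    induction k with
    | zero => exact hpos h
    | succ k ih => simpa [hh] using hsub ih
  · intro t
    -- Terms of the Neumann series for the preimage of `t`; the images of its partial sums telescope
    -- to `t - u k`.
    let u : ℕ → MvPowerSeries (Fin n) K := fun k => (fun h => h - substAlgHom (R := K) ha h)^[k] t
    have hu : ∀ k, u (k + 1) = u k - substAlgHom (R := K) ha (u k) := fun k =>
      Function.iterate_succ_apply' _ _ _
    have hord : ∀ k : ℕ, OrderGE L k (u k) := by
      intro k
      induction k with
      | zero => exact hpos _
      | succ k ih =>
        rw [hu]
        exact hsub ih
    obtain ⟨h, hh⟩ := OrderGE.exists_limit L u hord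
    refine ⟨h, sub_eq_zero.1 (OrderGE.eq_zero (D := L) fun k => ?_)⟩
    have htel : substAlgHom (R := K) ha (∑ j ∈ Finset.range k, u j) = t - u k := by
      have hj : ∀ j, substAlgHom (R := K) ha (u j) = u j - u (j + 1) := fun j => by
        rw [hu, sub_sub_cancel]
      rw [map_sum, Finset.sum_congr rfl fun j _ => hj j]
      exact Finset.sum_range_sub' u k
    have h1 : OrderGE L k (substAlgHom (R := K) ha (h - ∑ j ∈ Finset.range k, u j)) := by
      rw [substAlgHom_apply]
      exact (hh k).subst hL (hη.mono zero_le_one)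
    rw [map_sub, htel] at h1
    rw [show ∀ a b c : MvPowerSeries (Fin n) K, a - b = a - (b - c) - c by intros; ring]
    exact h1.sub (hord k)

end MvPowerSeries

/-! ### The piecewise valuation as a family of additive orders -/

namespace CPolytope

open MvPowerSeries

variable {n : ℕ} (P : CPolytope n) {K : Type*} [Field K]

theorem denom_pos : 0 < P.denom := by
  refine Nat.pos_of_ne_zero fun h => ?_
  obtain ⟨w, -, hw⟩ := Finset.lcm_eq_zero_iff.1 h
  obtain ⟨j, -, hj⟩ := Finset.lcm_eq_zero_iff.1 hw
  exact (w j).den_nz hj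

/-- The linear form `N_P · w` on exponents. -/
noncomputable def weightHom (w : Fin n → ℚ) : (Fin n →₀ ℕ) →+ ℝ where
  toFun α := P.denom * ∑ j, (w j : ℝ) * α j
  map_zero' := by simp
  map_add' α β := by simp [mul_add, Finset.sum_add_distrib]

theorem weightHom_apply (w : Fin n → ℚ) (α : Fin n →₀ ℕ) :
    P.weightHom w α = P.denom * ∑ j, (w j : ℝ) * α j := rfl

theorem weightHom_single_pos {w : Fin n → ℚ} (hw : w ∈ P.weights) (i : Fin n) :
    0 < P.weightHom w (Finsupp.single i 1) := by
  classical
  rw [weightHom_apply]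
  have h1 : (0 : ℝ) < P.denom := by exact_mod_cast P.denom_pos
  have h2 : (0 : ℝ) < w i := by exact_mod_cast P.pos w hw i
  simpa [Finsupp.single_apply, h1] using h2

theorem le_deg (c : ℤ) (z : Fin n → ℤ) :
    c ≤ P.deg z ↔ ∀ w ∈ P.weights, (c : ℝ) ≤ P.denom * ∑ j, (w j : ℝ) * z j := by
  have h1 : (0 : ℝ) < P.denom := by exact_mod_cast P.denom_pos
  rw [← Int.cast_le (R := ℝ), coe_deg, mul_comm, ← div_le_iff₀ h1, lam, Finset.le_inf'_iff]
  refine forall₂_congr fun w _ => ?_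
  rw [div_le_iff₀ h1, mul_comm]

theorem le_deg_latticePoint (c : ℤ) (α : Fin n →₀ ℕ) :
    c ≤ P.deg (latticePoint α) ↔ ∀ w ∈ P.weights, (c : ℝ) ≤ P.weightHom w α := by
  simp [le_deg, weightHom_apply, latticePoint]

theorem le_deg_latticePoint_sub (c : ℤ) (α : Fin n →₀ ℕ) (i : Fin n) :
    c ≤ P.deg (latticePoint α - Pi.single i 1) ↔
      ∀ w ∈ P.weights, P.weightHom w (Finsupp.single i 1) + c ≤ P.weightHom w α := by
  classical
  rw [le_deg]
  refine forall₂_congr fun w _ => ?_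
  have h : (P.denom : ℝ) * ∑ j, (w j : ℝ) * ((latticePoint α - Pi.single i 1 : Fin n → ℤ) j : ℝ) =
      P.weightHom w α - P.weightHom w (Finsupp.single i 1) := by
    simp [weightHom_apply, latticePoint, mul_sub, Finset.sum_sub_distrib, Finsupp.single_apply,
      Pi.single_apply]
  rw [h, le_sub_iff_add_le, add_comm]

theorem coe_le_val (f : MvPowerSeries (Fin n) K) (c : ℤ) :
    (c : WithTop ℤ) ≤ P.val f ↔ ∀ w ∈ P.weights, OrderGE (P.weightHom w) c f := by
  simp only [le_val, WithTop.coe_le_coe, le_deg_latticePoint, OrderGE]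
  exact ⟨fun h w hw α hα => h α hα w hw, fun h α hα w hw => h w hw α hα⟩

theorem coe_le_valDer
    (ξ : Derivation K (MvPowerSeries (Fin n) K) (MvPowerSeries (Fin n) K)) (c : ℤ) :
    (c : WithTop ℤ) ≤ P.valDer ξ ↔
      ∀ w ∈ P.weights, TupleOrderGE (P.weightHom w) c fun i => ξ (X i) := by
  simp only [le_valDer, WithTop.coe_le_coe, le_deg_latticePoint_sub, TupleOrderGE, OrderGE]
  exact ⟨fun h w hw i α hα => h i α hα w hw, fun h i α hα w hw => h w hw i α hα⟩

/-- Merges the bounds for all weights into one non-additive order, so that `OrderGE.exists_limit`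
yields a single limit valid for every weight. -/
theorem forall_tupleOrderGE_iff (η : Fin n → MvPowerSeries (Fin n) K) (c : ℤ) :
    (∀ w ∈ P.weights, TupleOrderGE (P.weightHom w) c η) ↔
      ∀ i, OrderGE (fun α => (P.deg (latticePoint α - Pi.single i 1) : ℝ)) c (η i) := by
  simp only [TupleOrderGE, OrderGE, Int.cast_le, le_deg_latticePoint_sub]
  exact ⟨fun h i α hα w hw => h w hw i α hα, fun h w hw i α hα => h i α hα w hw⟩

theorem val_monomial (α : Fin n →₀ ℕ) :
    P.val (monomial α (1 : K)) = (P.deg (latticePoint α) : WithTop ℤ) := by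
  classical
  refine eq_of_forall_le_iff fun c => ?_
  rw [le_val]
  refine ⟨fun h => h α (by simp), fun h β hβ => ?_⟩
  rw [coeff_monomial] at hβ
  split_ifs at hβ with hβα
  · rwa [hβα]
  · exact absurd rfl hβ

theorem mem_filtration {d : ℕ} {f : MvPowerSeries (Fin n) K} :
    f ∈ P.filtration K d ↔ ((d : ℤ) : WithTop ℤ) ≤ P.val f := Iff.rfl

/-- The degrees of monomials are nonnegative integers, so the minimum is attained. -/
theorem exists_val_eq {f : MvPowerSeries (Fin n) K} (hf : f ≠ 0) :
    ∃ α, coeff α f ≠ 0 ∧ P.val f = (P.deg (latticePoint α) : WithTop ℤ) := by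
  obtain ⟨α, hα⟩ := MvPowerSeries.ne_zero_iff_exists_coeff_ne_zero f |>.1 hf
  have hne : ∃ m : ℕ, ∃ α, coeff α f ≠ 0 ∧ P.deg (latticePoint α) = m :=
    ⟨_, α, hα, (Int.toNat_of_nonneg (P.deg_nonneg α)).symm⟩
  classical
  obtain ⟨β, hβ, hm⟩ := Nat.find_spec hne
  refine ⟨β, hβ, le_antisymm ((P.le_val f _).1 le_rfl β hβ) ((P.le_val f _).2 fun γ hγ => ?_)⟩
  rw [WithTop.coe_le_coe, hm, ← Int.toNat_of_nonneg (P.deg_nonneg γ)]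
  exact_mod_cast Nat.find_min' hne ⟨γ, hγ, (Int.toNat_of_nonneg (P.deg_nonneg γ)).symm⟩

theorem exists_nat_val_eq {f : MvPowerSeries (Fin n) K} (hf : f ≠ 0) :
    ∃ v : ℕ, P.val f = ((v : ℤ) : WithTop ℤ) := by
  obtain ⟨α, -, h⟩ := P.exists_val_eq hf
  exact ⟨(P.deg (latticePoint α)).toNat, by rw [Int.toNat_of_nonneg (P.deg_nonneg α), h]⟩

theorem coeff_initialForm (f : MvPowerSeries (Fin n) K) (α : Fin n →₀ ℕ) :
    coeff α (P.initialForm f) =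
      if (P.deg (latticePoint α) : WithTop ℤ) = P.val f then coeff α f else 0 := rfl

theorem val_initialForm (f : MvPowerSeries (Fin n) K) : P.val (P.initialForm f) = P.val f := by
  classical
  rcases eq_or_ne f 0 with rfl | hf
  · congr 1
    ext α
    rw [coeff_initialForm, map_zero, ite_self]
  refine le_antisymm ?_ ((P.le_val _ _).2 fun α hα => ?_)
  · obtain ⟨α, hα, h⟩ := P.exists_val_eq hf
    rw [h]
    refine (P.le_val _ _).1 le_rfl α ?_
    rwa [coeff_initialForm, if_pos h.symm]
  · rw [coeff_initialForm] at hα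
    split_ifs at hα with h
    · exact h.ge
    · exact absurd rfl hα

theorem le_val_sub_initialForm {f : MvPowerSeries (Fin n) K} {v : ℕ}
    (hv : P.val f = ((v : ℤ) : WithTop ℤ)) :
    (((v + 1 : ℕ) : ℤ) : WithTop ℤ) ≤ P.val (f - P.initialForm f) := by
  classical
  refine (P.le_val _ _).2 fun α hα => ?_
  rw [map_sub, coeff_initialForm] at hα
  split_ifs at hα with h
  · exact absurd (sub_self _) hα
  · rw [sub_zero] at hα
    have h1 := (P.le_val f _).1 le_rfl α hα
    rw [hv] at h h1
    have h2 := lt_of_le_of_ne h1 (Ne.symm h)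
    rw [WithTop.coe_lt_coe] at h2
    rw [WithTop.coe_le_coe]
    push_cast
    exact h2

/-! ### Vanishing of the high graded pieces -/

theorem filtration_le_of_subsingleton {f : MvPowerSeries (Fin n) K} {e : ℕ}
    (h : Subsingleton (P.GrAPiece f e)) :
    P.filtration K e ≤ P.jacobianA f e ⊔ P.filtration K (e + 1) := by
  intro g hg
  have h0 : (P.grARelations f e).mkQ ⟨g, hg⟩ = 0 := h.elim _ _
  rw [Submodule.mkQ_apply, Submodule.Quotient.mk_eq_zero] at h0
  exact h0

/-- The projection to degree `e` kills every class in a spanning set of homogeneous elements of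
other degrees, so it is zero; it is also surjective. -/
theorem subsingleton_grAPiece {f : MvPowerSeries (Fin n) K} {Λ : Set (Fin n →₀ ℕ)}
    (hΛ : Submodule.span K (P.monomialClass f '' Λ) = ⊤) {e : ℕ}
    (he : ∀ α ∈ Λ, P.deg (latticePoint α) ≠ e) : Subsingleton (P.GrAPiece f e) := by
  have hzero : DirectSum.component K ℕ (P.GrAPiece f) e = 0 := by
    refine LinearMap.ext_on hΛ ?_
    rintro _ ⟨α, hα, rfl⟩
    refine DirectSum.of_eq_of_ne _ _ _ fun h => he α hα ?_
    rw [h, Int.toNat_of_nonneg (P.deg_nonneg α)]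
  refine subsingleton_of_forall_eq 0 fun x => ?_
  have h := LinearMap.congr_fun hzero (DirectSum.lof K ℕ (P.GrAPiece f) e x)
  rwa [DirectSum.component.lof_self, LinearMap.zero_apply] at h

/-- For `f = 0` the Jacobian part is zero, so `F_e = F_{e+1}` for all `e > d`; a high power of the
first variable contradicts this. -/
theorem ne_zero_of_filtration_le (hn : 1 ≤ n) {f : MvPowerSeries (Fin n) K} {d : ℕ}
    (h : ∀ e : ℕ, d < e → P.filtration K e ≤ P.jacobianA f e ⊔ P.filtration K (e + 1)) :
    f ≠ 0 := by
  rintro rfl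
  obtain ⟨w, hw⟩ := P.nonempty
  let α : Fin n →₀ ℕ := Finsupp.single ⟨0, hn⟩ 1
  have hbig : ∃ k : ℕ, (d : ℤ) + 1 ≤ P.deg (latticePoint (k • α)) := by
    choose! k hk using fun w (hw : w ∈ P.weights) =>
      Archimedean.arch ((d : ℝ) + 1) (P.weightHom_single_pos hw ⟨0, hn⟩)
    refine ⟨P.weights.sup k, (P.le_deg_latticePoint _ _).2 fun w hw => ?_⟩
    rw [map_nsmul]
    push_cast
    exact (hk w hw).trans
      (nsmul_le_nsmul_left (P.weightHom_single_pos hw _).le (Finset.le_sup hw))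
  obtain ⟨k, hk⟩ := hbig
  set e := (P.deg (latticePoint (k • α))).toNat with he
  have he' : (e : ℤ) = P.deg (latticePoint (k • α)) := Int.toNat_of_nonneg (P.deg_nonneg _)
  have hmem := h e (by lia) (P.monomial_mem_filtration (K := K) (k • α))
  have hJ : P.jacobianA (0 : MvPowerSeries (Fin n) K) e = ⊥ := by
    rw [eq_bot_iff]
    rintro _ ⟨ξ, -, rfl⟩
    simp
  rw [hJ, bot_sup_eq, mem_filtration, val_monomial, WithTop.coe_le_coe, ← he'] at hmem
  lia

/-! ### Successive approximation of the equivalence -/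

/-- The error is `ξ(In f) + q` with `q ∈ F_{e+1}`. Both the Taylor remainder and `ξ(f - In f)` have
order at least `v + (e - v) + 1 = e + 1`. -/
theorem exists_derivation_improvement {f : MvPowerSeries (Fin n) K} {v e : ℕ}
    (hv : P.val f = ((v : ℤ) : WithTop ℤ)) (hve : v + 1 ≤ e)
    (h : P.filtration K e ≤ P.jacobianA (P.initialForm f) e ⊔ P.filtration K (e + 1))
    {η : Fin n → MvPowerSeries (Fin n) K}
    (hη : ∀ w ∈ P.weights, TupleOrderGE (P.weightHom w) 1 η) {r : MvPowerSeries (Fin n) K}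
    (hr : r - subst (fun i => X i + η i) f ∈ P.filtration K e) :
    ∃ ξ : Fin n → MvPowerSeries (Fin n) K,
      (∀ w ∈ P.weights, TupleOrderGE (P.weightHom w) (e - v : ℤ) ξ) ∧
      r - subst (fun i => X i + (η + ξ) i) f ∈ P.filtration K (e + 1) := by
  obtain ⟨_, ⟨ξ, hξ, rfl⟩, q, hq, hsum⟩ := Submodule.mem_sup.1 (h hr)
  have hξ' : (((e - v : ℤ)) : WithTop ℤ) ≤ P.valDer ξ := by
    rw [val_initialForm, hv] at hξ
    cases hd : P.valDer ξ with
    | top => exact le_top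
    | coe c =>
      rw [hd, ← WithTop.coe_add, WithTop.coe_le_coe] at hξ
      rw [WithTop.coe_le_coe]
      lia
  rw [coe_le_valDer] at hξ'
  refine ⟨fun i => ξ (X i), hξ', (P.coe_le_val _ _).2 fun w hw => ?_⟩
  have hL := P.weightHom_single_pos hw
  have hf := (P.coe_le_val f v).1 hv.ge w hw
  have hf' := (P.coe_le_val _ _).1 (P.le_val_sub_initialForm hv) w hw
  have hq' := (P.coe_le_val _ _).1 ((P.mem_filtration).1 hq) w hw
  have hve' : (v : ℝ) + 1 ≤ e := by exact_mod_cast hve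
  have h1 := hf.subst_sub_sub_derivation (by push_cast; linarith) hL (hη w hw) (hξ' w hw)
  have h2 := hf'.derivation (hξ' w hw)
  rw [map_sub] at h2
  push_cast at h1 h2 hq' ⊢
  have key : r - subst (fun i => X i + (η + fun i => ξ (X i)) i) f =
      q - (subst (fun i => X i + (η + fun i => ξ (X i)) i) f - subst (fun i => X i + η i) f - ξ f) -
        (ξ f - ξ (P.initialForm f)) := by
    linear_combination -hsum
  rw [key]
  exact (hq'.sub (h1.mono (by linarith))).sub (h2.mono (by linarith))

theorem exists_subst_eq {f g : MvPowerSeries (Fin n) K} {v d : ℕ}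
    (hv : P.val f = ((v : ℤ) : WithTop ℤ)) (hvd : v ≤ d)
    (h : ∀ e : ℕ, d < e →
      P.filtration K e ≤ P.jacobianA (P.initialForm f) e ⊔ P.filtration K (e + 1))
    (hg : g - f ∈ P.filtration K (d + 1)) :
    ∃ η : Fin n → MvPowerSeries (Fin n) K,
      (∀ w ∈ P.weights, TupleOrderGE (P.weightHom w) 1 η) ∧
      subst (fun i => X i + η i) f = g := by
  -- The hypotheses on `η` sit under the existential so that `choose` gives a total correction
  -- function. At level `e = d + 1 + k` the correction has order at least `e - v ≥ k + 1`.
  have step : ∀ (k : ℕ) (η : Fin n → MvPowerSeries (Fin n) K),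
      ∃ ξ : Fin n → MvPowerSeries (Fin n) K,
      (∀ w ∈ P.weights, TupleOrderGE (P.weightHom w) 1 η) →
      g - subst (fun i => X i + η i) f ∈ P.filtration K (d + 1 + k) →
      (∀ w ∈ P.weights, TupleOrderGE (P.weightHom w) (((k + 1 : ℕ) : ℤ) : ℝ) ξ) ∧
      g - subst (fun i => X i + (η + ξ) i) f ∈ P.filtration K (d + 1 + (k + 1)) := by
    intro k η
    by_cases hη : (∀ w ∈ P.weights, TupleOrderGE (P.weightHom w) 1 η) ∧
      g - subst (fun i => X i + η i) f ∈ P.filtration K (d + 1 + k)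
    · obtain ⟨ξ, h1, h2⟩ := P.exists_derivation_improvement hv (by lia)
        (h (d + 1 + k) (by lia)) hη.1 hη.2
      refine ⟨ξ, fun _ _ => ⟨fun w hw => (h1 w hw).mono ?_, h2⟩⟩
      rw [Int.cast_le]
      push_cast
      lia
    · exact ⟨0, fun h1 h2 => absurd ⟨h1, h2⟩ hη⟩
  choose ξ hξ using step
  let η : ℕ → Fin n → MvPowerSeries (Fin n) K := fun k => Nat.rec 0 (fun k η => η + ξ k η) k
  have hη_succ : ∀ k, η (k + 1) = η k + ξ k (η k) := fun _ => rfl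
  have hη : ∀ k, (∀ w ∈ P.weights, TupleOrderGE (P.weightHom w) 1 (η k)) ∧
      g - subst (fun i => X i + η k i) f ∈ P.filtration K (d + 1 + k) := by
    intro k
    induction k with
    | zero =>
      refine ⟨fun w _ i => OrderGE.zero, ?_⟩
      rw [show η 0 = 0 from rfl, subst_X_add_zero]
      exact hg
    | succ k ih =>
      have hk := hξ k (η k) ih.1 ih.2
      exact ⟨fun w hw => (ih.1 w hw).add ((hk.1 w hw).mono (by simp)), hk.2⟩
  have hinc : ∀ (k : ℕ) i, OrderGE (fun α => (P.deg (latticePoint α - Pi.single i 1) : ℝ)) k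
      (ξ k (η k) i) := fun k i =>
    ((P.forall_tupleOrderGE_iff _ _).1 (hξ k (η k) (hη k).1 (hη k).2).1 i).mono (by simp)
  choose ζ hζ using fun i => OrderGE.exists_limit _ _ fun k => hinc k i
  have hsum : ∀ k i, ∑ j ∈ Finset.range k, ξ j (η j) i = η k i := by
    intro k i
    induction k with
    | zero => rfl
    | succ k ih => rw [Finset.sum_range_succ, ih, hη_succ, Pi.add_apply]
  have hdiff : ∀ k : ℕ, ∀ w ∈ P.weights, TupleOrderGE (P.weightHom w) k (ζ - η k) := by
    intro k
    have := (P.forall_tupleOrderGE_iff (ζ - η k) k).2 fun i => by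
      simpa [hsum] using hζ i k
    simpa using this
  refine ⟨ζ, fun w hw => ?_, ?_⟩
  -- The comparison is with `η 1`, since `hdiff 0` would bound the order only by 0.
  · have h1 := (hη 1).1 w hw
    have h2 := hdiff 1 w hw
    rw [Nat.cast_one] at h2
    simpa using h1.add h2
  -- Equality of series can be tested with the order of a single weight.
  · obtain ⟨w, hw⟩ := P.nonempty
    refine sub_eq_zero.1 (OrderGE.eq_zero (D := P.weightHom w) fun k => ?_)
    have h1 := ((P.coe_le_val f v).1 hv.ge w hw).subst_sub (Nat.cast_nonneg k)
      (P.weightHom_single_pos hw) (((hη k).1 w hw).mono zero_le_one) (hdiff k w hw)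
    have h2 := (P.coe_le_val _ _).1 ((P.mem_filtration).1 (hη k).2) w hw
    rw [add_sub_cancel] at h1
    push_cast at h1 h2
    have h3 := (h1.mono (d := k) (by linarith [(Nat.cast_nonneg v : (0 : ℝ) ≤ v)])).sub
      (h2.mono (d := k) (by linarith [(Nat.cast_nonneg d : (0 : ℝ) ≤ d)]))
    simpa using h3

/-- The substitution found sends `f` to `g`, so its inverse is the required automorphism. -/
theorem rightEquivalent_of_filtration_le {f g : MvPowerSeries (Fin n) K} {v d : ℕ}
    (hv : P.val f = ((v : ℤ) : WithTop ℤ)) (hvd : v ≤ d)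
    (h : ∀ e : ℕ, d < e →
      P.filtration K e ≤ P.jacobianA (P.initialForm f) e ⊔ P.filtration K (e + 1))
    (hg : f - g ∈ P.filtration K (d + 1)) : RightEquivalent f g := by
  obtain ⟨η, hη, rfl⟩ := P.exists_subst_eq hv hvd h (by simpa using neg_mem hg)
  obtain ⟨w, hw⟩ := P.nonempty
  have hL := P.weightHom_single_pos hw
  have ha := hasSubst_X_add hL zero_le_one (hη w hw)
  refine ⟨(AlgEquiv.ofBijective _ (bijective_substAlgHom hL (hη w hw) ha)).symm, ?_⟩
  rw [AlgEquiv.eq_symm_apply, AlgEquiv.coe_ofBijective, substAlgHom_apply]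

/-! ### Powers of the maximal ideal and the determinacy bound -/

theorem monomial_mem_maximalIdeal_pow (α : Fin n →₀ ℕ) :
    monomial α (1 : K) ∈ IsLocalRing.maximalIdeal (MvPowerSeries (Fin n) K) ^ α.degree := by
  induction α using monomial_induction with
  | h0 => simp
  | h β i ih =>
    rw [monomial_add_single, map_add, Finsupp.degree_single, pow_succ]
    refine Ideal.mul_mem_mul ih ?_
    rw [IsLocalRing.mem_maximalIdeal, mem_nonunits_iff, isUnit_iff_constantCoeff, constantCoeff_X]
    exact not_isUnit_zero

/-- Membership in `F_e` is a condition on monomials, so it suffices to place each monomial of `f -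
g` in the power of the maximal ideal. -/
theorem sub_mem_filtration_of_pow_le {k e : ℕ}
    (hk : IsLocalRing.maximalIdeal (MvPowerSeries (Fin n) K) ^ (k + 1) ≤ P.filtration K e)
    {f g : MvPowerSeries (Fin n) K}
    (h : ∀ α : Fin n →₀ ℕ, α.degree ≤ k → coeff α f = coeff α g) :
    f - g ∈ P.filtration K e := by
  refine (P.le_val _ _).2 fun α hα => ?_
  have hdeg : k + 1 ≤ α.degree := by
    by_contra! hlt
    exact hα (by rw [map_sub, h α (by lia), sub_self])
  rw [← P.val_monomial (K := K)]
  exact hk (Ideal.pow_le_pow_right hdeg (monomial_mem_maximalIdeal_pow α))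

end CPolytope

theorem corollary4p7 {K : Type*} [Field K] [IsAlgClosed K] (n : ℕ) (hn : 1 ≤ n)
    (P : CPolytope n) (f : MvPowerSeries (Fin n) K)
    (hf : f ∈ IsLocalRing.maximalIdeal (MvPowerSeries (Fin n) K))
    (hAA : P.ConditionAA (P.initialForm f))
    (Λ : Set (Fin n →₀ ℕ)) (hΛ : P.IsRegularBasis (P.initialForm f) Λ) :
    ∃ d : ℕ,
      IsGreatest
        ({P.val (P.initialForm f)} ∪
          (fun α => P.val (MvPowerSeries.monomial α (1 : K))) '' Λ)
        ((d : ℤ) : WithTop ℤ) ∧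
      (∀ g : MvPowerSeries (Fin n) K, ((d : ℤ) : WithTop ℤ) < P.val (f - g) →
        RightEquivalent f g) ∧
      ∀ k : ℕ,
        IsLocalRing.maximalIdeal (MvPowerSeries (Fin n) K) ^ (k + 1) ≤ P.filtration K (d + 1) →
          RightDetermined k f := by
  -- Linear independence enters only here; the vanishing of the graded pieces uses spanning alone.
  have hfin : Λ.Finite := by
    have : Module.Finite K (P.GrA (P.initialForm f)) := hAA
    exact Set.finite_coe_iff.1 hΛ.1.finite
  have hpiece : ∀ e : ℕ, (∀ α ∈ Λ, P.deg (CPolytope.latticePoint α) < e) →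
      P.filtration K e ≤ P.jacobianA (P.initialForm f) e ⊔ P.filtration K (e + 1) :=
    fun e he => P.filtration_le_of_subsingleton
      (P.subsingleton_grAPiece hΛ.2 fun α hα => (he α hα).ne)
  -- This makes `v_P(f)` finite, and with it the maximum `d`.
  have hne : f ≠ 0 := by
    obtain ⟨b, hb⟩ := (hfin.image fun α => P.deg (CPolytope.latticePoint α)).bddAbove
    have h0 : P.initialForm f ≠ 0 := P.ne_zero_of_filtration_le hn (d := b.toNat) fun e he =>
      hpiece e fun α hα => by
        have := hb (Set.mem_image_of_mem _ hα)
        lia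
    rintro rfl
    refine h0 (MvPowerSeries.ext fun α => ?_)
    rw [P.coeff_initialForm, map_zero, ite_self]
  obtain ⟨v, hv⟩ := P.exists_nat_val_eq hne
  obtain ⟨m, hm⟩ : ∃ m, IsGreatest ({P.val (P.initialForm f)} ∪
      (fun α => P.val (MvPowerSeries.monomial α (1 : K))) '' Λ) m := by
    have hS := (Set.finite_singleton (P.val (P.initialForm f))).union
      (hfin.image fun α => P.val (MvPowerSeries.monomial α (1 : K)))
    obtain ⟨m, hmS, hm⟩ := Set.exists_max_image _ id hS ⟨_, Or.inl rfl⟩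
    exact ⟨m, hmS, hm⟩
  obtain ⟨d, rfl⟩ : ∃ d : ℕ, m = ((d : ℤ) : WithTop ℤ) := by
    rcases hm.1 with h | ⟨α, -, h⟩
    · exact ⟨v, by rw [Set.mem_singleton_iff.1 h, P.val_initialForm, hv]⟩
    · refine ⟨(P.deg (CPolytope.latticePoint α)).toNat, ?_⟩
      rw [← h, Int.toNat_of_nonneg (P.deg_nonneg α)]
      exact P.val_monomial α
  have hvd : v ≤ d := by
    have h := hm.2 (Or.inl rfl)
    rw [P.val_initialForm, hv, WithTop.coe_le_coe] at h
    exact_mod_cast h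
  have hΛd : ∀ α ∈ Λ, P.deg (CPolytope.latticePoint α) ≤ d := fun α hα => by
    have h := hm.2 (Or.inr ⟨α, hα, rfl⟩)
    dsimp only at h
    rwa [P.val_monomial, WithTop.coe_le_coe] at h
  have hequiv : ∀ g : MvPowerSeries (Fin n) K, f - g ∈ P.filtration K (d + 1) →
      RightEquivalent f g := fun g => P.rightEquivalent_of_filtration_le hv hvd fun e he =>
    hpiece e fun α hα => (hΛd α hα).trans_lt (by exact_mod_cast he)
  refine ⟨d, hm, fun g hg => hequiv g ?_, fun k hk g hg =>
    hequiv g (P.sub_mem_filtration_of_pow_le hk hg)⟩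
  rw [P.mem_filtration]
  cases h : P.val (f - g) with
  | top => exact le_top
  | coe c =>
    rw [h, WithTop.coe_lt_coe] at hg
    rw [WithTop.coe_le_coe]
    push_cast
    exact hg
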